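/- Let $\mathcal A=\mathbb R^m$, $\mathcal X=\mathbb R^N$, $\mathcal Y=\mathbb R^P$, let $\Theta\subseteq\mathbb R^d$ be open, and consider the iterative scheme $$x^{(\ell)}(y,\theta)=\gamma\big(a^{(\ell)}(y,\theta)\big),\qquad a^{(\ell+1)}(y,\theta)=\psi\big(a^{(\ell)}(y,\theta),y,\theta\big),\qquad a^{(0)}(y,\theta)=a_0(y,\theta),$$ with $\gamma:\mathcal A\to\mathcal X$ and $\psi:\mathcal A\times\mathcal Y\times\Theta\to\mathcal A$. Fix $y\in\mathcal Y$ and assume that $\gamma$ is non-expansive ($1$-Lipschitz), that $a\mapsto\psi(a,y,\theta)$ is Lipschitz with a constant independent of $\theta\in\Theta$, that $\theta\mapsto\psi(a,y,\theta)$ is Lipschitz on $\Theta$ with a constant independent of $a\in\mathcal A$, and that $\theta\mapsto a_0(y,\theta)$ is Lipschitz on $\Theta$. A weak partial derivative of a locally integrable $f:\Omega\to\mathbb R$ ($\Omega\subseteq\mathbb R^n$ open) in the $i$-th coordinate is a locally integrable $g$ on $\Omega$ with $\int_\Omega g\varphi=-\int_\Omega f\,\partial_i\varphi$ for all $\varphi\in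 C^1_c(\Omega)$; the weak Jacobian of a vector-valued map is the matrix field of the weak partial derivatives of its components. It is determined only Lebesgue-almost everywhere, and a particular representative is called a version of it. Then, for every $\ell\ge 0$, the maps $\theta\mapsto a^{(\ell)}(y,\theta)$ and $\theta\mapsto x^{(\ell)}(y,\theta)$ are weakly differentiable on $\Theta$. Moreover there are a version $\mathrm D\gamma$ of the weak Jacobian of $\gamma$ on $\mathcal A$, and maps $\mathrm D_1\psi(\cdot,y,\cdot)$ and $\mathrm D_3\psi(\cdot,y,\cdot)$ on $\mathcal A\times\Theta$ such that $\mathrm D_1\psi(\cdot,y,\theta)$ is a version of the weak Jacobian of $\psi(\cdot,y,\theta)$ on $\mathcal A$ for every $\theta\in\Theta$, and $\mathrm D_3\psi(a,y,\cdot)$ is a version of the weak Jacobian of $\psi(a,y,\cdot)$ on $\Theta$ for every $a\in\mathcal A$, each of the three coinciding with the corresponding classical (partial) Jacobian at every point where the latter exists, such that the weak Jacobians $\mathcal J_a^{(\ell)}$ and $\mathcal J_x^{(\ell)}$ of $\theta\mapsto a^{(\ell)}(y,\theta)$ and $\theta\mapsto x^{(\ell)}(y,\theta)$ on $\Theta$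 satisfy, for every $\ell\ge 0$ and Lebesgue-almost every $\theta\in\Theta$, $$\mathcal J_x^{(\ell)}=\Gamma_a^{(\ell)}\,\mathcal J_a^{(\ell)},\qquad \mathcal J_a^{(\ell+1)}=\Psi_a^{(\ell)}\,\mathcal J_a^{(\ell)}+\Psi_\theta^{(\ell)},$$ where $\Gamma_a^{(\ell)}=\mathrm D\gamma(a^{(\ell)})$, $\Psi_a^{(\ell)}=\mathrm D_1\psi(a^{(\ell)},y,\theta)$ and $\Psi_\theta^{(\ell)}=\mathrm D_3\psi(a^{(\ell)},y,\theta)$ with $a^{(\ell)}=a^{(\ell)}(y,\theta)$. -/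

import Mathlib

open MeasureTheory

/-- `g` is a weak partial derivative of `f` with respect to the `i`-th coordinate on the open
set `Ω ⊆ ℝⁿ`: both are locally integrable on `Ω`, and
`∫_Ω g φ = - ∫_Ω f ∂φ/∂aᵢ` for all `φ ∈ C_c¹(Ω)`. -/
def IsWeakPartialDeriv {n : ℕ} (Ω : Set (EuclideanSpace ℝ (Fin n))) (i : Fin n)
    (f g : EuclideanSpace ℝ (Fin n) → ℝ) : Prop :=
  LocallyIntegrableOn f Ω volume ∧ LocallyIntegrableOn g Ω volume ∧
    ∀ φ : EuclideanSpace ℝ (Fin n) → ℝ,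
      ContDiff ℝ 1 φ → HasCompactSupport φ → tsupport φ ⊆ Ω →
        ∫ a in Ω, g a * φ a = - ∫ a in Ω, f a * fderiv ℝ φ a (EuclideanSpace.single i 1)

/-- `J` is (a version of) the weak Jacobian of `h : ℝⁿ → ℝᵖ` on the open set `Ω`: the entry
`(k, i)` of `J` is a weak partial derivative of the component `h_k` in the `i`-th coordinate. -/
def IsWeakJacobian {n p : ℕ} (Ω : Set (EuclideanSpace ℝ (Fin n)))
    (h : EuclideanSpace ℝ (Fin n) → EuclideanSpace ℝ (Fin p))
    (J : EuclideanSpace ℝ (Fin n) → EuclideanSpace ℝ (Fin n) →L[ℝ] EuclideanSpace ℝ (Fin p)) :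
    Prop :=
  ∀ (k : Fin p) (i : Fin n),
    IsWeakPartialDeriv Ω i (fun a => h a k) (fun a => J a (EuclideanSpace.single i 1) k)

/-- `h` is weakly differentiable on `Ω`: all weak partial derivatives of its components exist. -/
def WeaklyDifferentiableOn {n p : ℕ} (Ω : Set (EuclideanSpace ℝ (Fin n)))
    (h : EuclideanSpace ℝ (Fin n) → EuclideanSpace ℝ (Fin p)) : Prop :=
  ∀ (k : Fin p) (i : Fin n), ∃ g : EuclideanSpace ℝ (Fin n) → ℝ,
    IsWeakPartialDeriv Ω i (fun a => h a k) g

/-- The auxiliary iterates `a⁽⁰⁾ = a₀`, `a⁽ˡ⁺¹⁾ = ψ(a⁽ˡ⁾, y, θ)`, as functions of `(y, θ)`. -/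
def auxIterate {A Y T : Type*} (ψ : A → Y → T → A) (a₀ : Y → T → A) : ℕ → Y → T → A
  | 0 => a₀
  | l + 1 => fun y θ => ψ (auxIterate ψ a₀ l y θ) y θ

/-- The iterates `x⁽ˡ⁾ = γ(a⁽ˡ⁾)`, as functions of `(y, θ)`. -/
def mainIterate {A X Y T : Type*} (γ : A → X) (ψ : A → Y → T → A) (a₀ : Y → T → A)
    (l : ℕ) (y : Y) (θ : T) : X :=
  γ (auxIterate ψ a₀ l y θ)

open Filter Topology Set Asymptotics

/-!
The classical chain rule is unavailable: the inner map may send `Θ` into the null set where the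
outer map is not differentiable. What survives is that, for Lipschitz `f` and `h`, at almost every
`x` the line derivatives of `f` at `h x` exist in the directions `Dh(x) v` and add up with all other
line derivatives of `f` there. Indeed, by Rademacher's theorem for the distance function, any set
approximates almost all of its points `x` to first order, i.e. `infDist (x + s • v) A = o(s)`; for
the sets `A` on which a difference quotient of `f` along `h` is uniformly close to its limit, this
moves line derivatives of `f` at `h x` to `h (x + s • v)`.

The directions with this additivity form a subspace depending on `f` alone, so any linear extension
of the line derivatives from it is a version of the Jacobian of `f` that obeys the chain rule for
every `h` at once. Additivity also makes it possible to choose the extension compatible with the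
partial Jacobians of `ψ` wherever these exist.
-/

section Linearity

variable {E F : Type*} [NormedAddCommGroup E] [NormedSpace ℝ E]
  [NormedAddCommGroup F] [NormedSpace ℝ F] {f g : E → F} {p w : E} {T S : E →L[ℝ] F}
  {V W : Submodule ℝ E}

/-- `f` is differentiable at `p` along the subspace `W`, with derivative `T`: on `W` the line
derivatives of `f` at `p` exist and are given by the linear map `T`, whose values outside `W` are
irrelevant. -/
def HasFDerivAlong (f : E → F) (T : E →L[ℝ] F) (W : Submodule ℝ E) (p : E) : Prop :=
  ∀ w ∈ W, HasLineDerivAt ℝ f (T w) p w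

/-- The subspace of the directions `w` in which `f` has a line derivative at `p` that adds up with
every other line derivative of `f` at `p`; that the former exists is the case `u = 0`. In the chain
rule only the values of the derivative of `f` on this subspace matter. -/
def additiveDirections (f : E → F) (p : E) : Submodule ℝ E where
  carrier := {w | ∀ u a, HasLineDerivAt ℝ f a p u →
    HasLineDerivAt ℝ f (a + lineDeriv ℝ f p w) p (u + w)}
  zero_mem' u a hu := by simpa [lineDeriv_zero] using hu
  add_mem' := by
    intro w₁ w₂ h₁ h₂
    have h₁₂ : lineDeriv ℝ f p (w₁ + w₂) = lineDeriv ℝ f p w₁ + lineDeriv ℝ f p w₂ := by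
      simpa using (h₂ _ _ (h₁ 0 0 hasLineDerivAt_zero)).lineDeriv
    intro u a hu
    simpa only [h₁₂, add_assoc] using h₂ _ _ (h₁ u a hu)
  smul_mem' := by
    intro c w hw u a hu
    rcases eq_or_ne c 0 with rfl | hc
    · simpa [lineDeriv_zero] using hu
    · simpa [smul_smul, hc, lineDeriv_smul] using (hw _ _ (hu.smul c⁻¹)).smul c

theorem hasLineDerivAt_of_mem_additiveDirections (hw : w ∈ additiveDirections f p) :
    HasLineDerivAt ℝ f (lineDeriv ℝ f p w) p w := by
  simpa using hw 0 0 hasLineDerivAt_zero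

theorem mem_additiveDirections_of_forall_hasLineDerivAt {b : F}
    (h : ∀ u a, HasLineDerivAt ℝ f a p u → HasLineDerivAt ℝ f (a + b) p (u + w)) :
    w ∈ additiveDirections f p := by
  have hb : lineDeriv ℝ f p w = b := by simpa using (h 0 0 hasLineDerivAt_zero).lineDeriv
  intro u a hu
  rw [hb]
  exact h u a hu

theorem additiveDirections_congr (h : f =ᶠ[𝓝 p] g) :
    additiveDirections f p = additiveDirections g p := by
  ext w
  change (∀ u a, _ → _) ↔ (∀ u a, _ → _)
  simp only [h.hasLineDerivAt_iff, h.lineDeriv_eq]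

theorem hasFDerivAlong_fderiv (h : DifferentiableAt ℝ f p) :
    HasFDerivAlong f (fderiv ℝ f p) W p := fun w _ => h.hasFDerivAt.hasLineDerivAt w

namespace HasFDerivAlong

theorem mono (h : HasFDerivAlong f T W p) (hVW : V ≤ W) : HasFDerivAlong f T V p :=
  fun w hw => h w (hVW hw)

theorem iSup_prop {P : Prop} (h : P → HasFDerivAlong f T W p) :
    HasFDerivAlong f T (⨆ _ : P, W) p := by
  intro w hw
  by_cases hP : P
  · exact h hP w (by simpa [hP] using hw)
  · have hw₀ : w = 0 := by simpa [hP] using hw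
    simpa [hw₀] using hasLineDerivAt_zero (𝕜 := ℝ) (f := f) (x := p)

theorem sup_additiveDirections (hW : HasFDerivAlong f T W p)
    (hA : HasFDerivAlong f T (additiveDirections f p) p) :
    HasFDerivAlong f T (W ⊔ additiveDirections f p) p := by
  intro x hx
  obtain ⟨w, hw, l, hl, rfl⟩ := Submodule.mem_sup.1 hx
  simpa only [(hA l hl).lineDeriv, ← map_add] using hl w (T w) (hW w hw)

/-- By uniqueness of line derivatives the two linear maps agree on `V ⊓ W`. -/
theorem exists_glue [FiniteDimensional ℝ E] (hV : HasFDerivAlong f S V p)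
    (hW : HasFDerivAlong f T W p) :
    ∃ R : E →L[ℝ] F, HasFDerivAlong f R V p ∧ HasFDerivAlong f R W p := by
  let SV : E →ₗ.[ℝ] F := ⟨V, S.toLinearMap.domRestrict V⟩
  let TW : E →ₗ.[ℝ] F := ⟨W, T.toLinearMap.domRestrict W⟩
  have hST : ∀ (x : SV.domain) (z : TW.domain), (x : E) = z → SV x = TW z := by
    rintro ⟨x, hx⟩ ⟨_, hz⟩ rfl
    exact (hV x hx).unique (hW x hz)
  obtain ⟨R, hR⟩ := LinearMap.exists_extend (SV.sup TW hST).toFun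
  have hRS : ∀ x ∈ V, R x = S x := fun x hx =>
    (LinearMap.congr_fun hR ⟨x, Submodule.mem_sup_left hx⟩).trans
      ((SV.left_le_sup TW hST).2 (x := ⟨x, hx⟩) rfl).symm
  have hRT : ∀ x ∈ W, R x = T x := fun x hx =>
    (LinearMap.congr_fun hR ⟨x, Submodule.mem_sup_right hx⟩).trans
      ((SV.right_le_sup TW hST).2 (x := ⟨x, hx⟩) rfl).symm
  refine ⟨LinearMap.toContinuousLinearMap R, fun x hx => ?_, fun x hx => ?_⟩
  · simpa [hRS x hx] using hV x hx
  · simpa [hRT x hx] using hW x hx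

end HasFDerivAlong

variable [FiniteDimensional ℝ E]

theorem exists_hasFDerivAlong_additiveDirections (f : E → F) (p : E) :
    ∃ T : E →L[ℝ] F, HasFDerivAlong f T (additiveDirections f p) p := by
  let g : additiveDirections f p →ₗ[ℝ] F :=
    { toFun := fun w => lineDeriv ℝ f p w
      map_add' := fun w₁ w₂ =>
        (w₂.2 _ _ (hasLineDerivAt_of_mem_additiveDirections w₁.2)).lineDeriv
      map_smul' := fun _ _ => lineDeriv_smul }
  obtain ⟨T, hT⟩ := LinearMap.exists_extend g
  refine ⟨LinearMap.toContinuousLinearMap T, fun w hw => ?_⟩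
  have hTw : T w = lineDeriv ℝ f p w := LinearMap.congr_fun hT ⟨w, hw⟩
  simpa [hTw] using hasLineDerivAt_of_mem_additiveDirections hw

theorem exists_hasFDerivAlong_additiveDirections_and_eq_fderiv (f : E → F) (p : E) :
    ∃ T : E →L[ℝ] F, HasFDerivAlong f T (additiveDirections f p) p ∧
      (DifferentiableAt ℝ f p → T = fderiv ℝ f p) := by
  by_cases h : DifferentiableAt ℝ f p
  · exact ⟨fderiv ℝ f p, hasFDerivAlong_fderiv h, fun _ => rfl⟩
  · obtain ⟨T, hT⟩ := exists_hasFDerivAlong_additiveDirections f p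
    exact ⟨T, hT, fun h' => absurd h' h⟩

/-- The two given derivatives need not be compatible on `V ⊔ W`: linearity along the additive
directions is what allows all three linear maps to be glued. -/
theorem exists_hasFDerivAlong_additiveDirections_and_of_imp {P Q : Prop}
    (hV : P → HasFDerivAlong f S V p) (hW : Q → HasFDerivAlong f T W p) :
    ∃ R : E →L[ℝ] F, HasFDerivAlong f R (additiveDirections f p) p ∧
      (P → HasFDerivAlong f R V p) ∧ (Q → HasFDerivAlong f R W p) := by
  obtain ⟨R₀, hR₀⟩ := exists_hasFDerivAlong_additiveDirections f p
  obtain ⟨R₁, hR₁V, hR₁⟩ := (HasFDerivAlong.iSup_prop hV).exists_glue hR₀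
  obtain ⟨R, hR, hRW⟩ := (hR₁V.sup_additiveDirections hR₁).exists_glue
    (HasFDerivAlong.iSup_prop hW)
  exact ⟨R, hR.mono le_sup_right, fun hP => hR.mono (le_sup_of_le_left (le_iSup_of_le hP le_rfl)),
    fun hQ => hRW.mono (le_iSup_of_le hQ le_rfl)⟩

end Linearity

section PartialDerivatives

variable {A D F : Type*} [NormedAddCommGroup A] [NormedSpace ℝ A]
  [NormedAddCommGroup D] [NormedSpace ℝ D] [NormedAddCommGroup F] [NormedSpace ℝ F]
  {f : A × D → F} {a : A} {t : D}

theorem hasLineDerivAt_inl (h : DifferentiableAt ℝ (fun b => f (b, t)) a) (v : A) :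
    HasLineDerivAt ℝ f (fderiv ℝ (fun b => f (b, t)) a v) (a, t) (v, 0) := by
  simpa [HasLineDerivAt] using h.hasFDerivAt.hasLineDerivAt v

theorem hasLineDerivAt_inr (h : DifferentiableAt ℝ (fun s => f (a, s)) t) (v : D) :
    HasLineDerivAt ℝ f (fderiv ℝ (fun s => f (a, s)) t v) (a, t) (0, v) := by
  simpa [HasLineDerivAt] using h.hasFDerivAt.hasLineDerivAt v

theorem exists_hasFDerivAlong_additiveDirections_and_eq_partial_fderiv [FiniteDimensional ℝ A]
    [FiniteDimensional ℝ D] (f : A × D → F) (a : A) (t : D) :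
    ∃ T : A × D →L[ℝ] F, HasFDerivAlong f T (additiveDirections f (a, t)) (a, t) ∧
      (DifferentiableAt ℝ (fun b => f (b, t)) a →
        T.comp (ContinuousLinearMap.inl ℝ A D) = fderiv ℝ (fun b => f (b, t)) a) ∧
      (DifferentiableAt ℝ (fun s => f (a, s)) t →
        T.comp (ContinuousLinearMap.inr ℝ A D) = fderiv ℝ (fun s => f (a, s)) t) := by
  obtain ⟨T, hT, hT₁, hT₂⟩ := exists_hasFDerivAlong_additiveDirections_and_of_imp
    (f := f) (p := (a, t))
    (V := LinearMap.range (LinearMap.inl ℝ A D))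
    (S := (fderiv ℝ (fun b => f (b, t)) a).comp (ContinuousLinearMap.fst ℝ A D))
    (W := LinearMap.range (LinearMap.inr ℝ A D))
    (T := (fderiv ℝ (fun s => f (a, s)) t).comp (ContinuousLinearMap.snd ℝ A D))
    (fun h => by rintro _ ⟨v, rfl⟩; exact hasLineDerivAt_inl h v)
    (fun h => by rintro _ ⟨v, rfl⟩; exact hasLineDerivAt_inr h v)
  refine ⟨T, hT, fun h => ?_, fun h => ?_⟩ <;> ext1 v
  · exact (hT₁ h (v, 0) ⟨v, rfl⟩).unique (hasLineDerivAt_inl h v)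
  · exact (hT₂ h (0, v) ⟨v, rfl⟩).unique (hasLineDerivAt_inr h v)

end PartialDerivatives

section TangentialLinearity

variable {D E F : Type*} [NormedAddCommGroup D] [NormedSpace ℝ D]
  [NormedAddCommGroup E] [NormedSpace ℝ E] [NormedAddCommGroup F]

theorem isLittleO_infDist_add_smul {A : Set E} {x : E} (hx : x ∈ A)
    (hd : DifferentiableAt ℝ (fun z => Metric.infDist z A) x) (v : E) :
    (fun s : ℝ => Metric.infDist (x + s • v) A) =o[𝓝 0] fun s => s := by
  have hmin : IsLocalMin (fun z => Metric.infDist z A) x := Eventually.of_forall fun z => by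
    simpa only [Metric.infDist_zero_of_mem hx] using Metric.infDist_nonneg
  have hv := hasLineDerivAt_iff_isLittleO_nhds_zero.1 (hd.hasFDerivAt.hasLineDerivAt v)
  simpa [hmin.fderiv_eq_zero, Metric.infDist_zero_of_mem hx] using hv

theorem norm_le_add_mul_infDist {X : Type*} [PseudoMetricSpace X] {G : Type*}
    [SeminormedAddCommGroup G] {r : X → G} {L : NNReal} (hr : LipschitzWith L r) {A : Set X}
    (hA : A.Nonempty) {c : ℝ} (hc : ∀ z ∈ A, ‖r z‖ ≤ c) (x : X) :
    ‖r x‖ ≤ c + L * Metric.infDist x A := by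
  have := hA.to_subtype
  rw [← sub_le_iff_le_add', Metric.infDist_eq_iInf, Real.mul_iInf_of_nonneg L.coe_nonneg]
  refine le_ciInf fun z => ?_
  have hxz := hr.dist_le_mul x z
  rw [dist_eq_norm] at hxz
  linarith [norm_le_norm_add_norm_sub' (r x) (r z), hc z z.2]

section Uniform

variable [FiniteDimensional ℝ D] [MeasurableSpace D] [BorelSpace D] {μ : Measure D}
  [μ.IsAddHaarMeasure]

theorem ae_isLittleO_infDist_add_smul (A : Set D) :
    ∀ᵐ x ∂μ, x ∈ A → ∀ v,
      (fun s : ℝ => Metric.infDist (x + s • v) A) =o[𝓝 0] fun s => s := by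
  filter_upwards [(Metric.lipschitz_infDist_pt A).ae_differentiableAt] with x hx hxA v
  exact isLittleO_infDist_add_smul hxA hx v

/-- The sets on which `‖R s ·‖ ≤ q * |s|` holds for all small `s` approximate their points to
first order almost everywhere, and the Lipschitz bound carries the estimate over to `x + s • v`. -/
theorem ae_isBigOWith_add_smul {R : ℝ → D → F} {L : NNReal} (hR : ∀ s, LipschitzWith L (R s)) :
    ∀ᵐ x ∂μ, ∀ c c' v, c < c' → IsBigOWith c (𝓝 0) (fun s => R s x) (fun s => s) →
      IsBigOWith c' (𝓝 0) (fun s => R s (x + s • v)) fun s => s := by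
  obtain ⟨U, hU⟩ := (𝓝 (0 : ℝ)).exists_antitone_basis
  let A (q : ℚ) (k : ℕ) : Set D := {x | ∀ s ∈ U k, ‖R s x‖ ≤ q * |s|}
  have hA : ∀ᵐ x ∂μ, ∀ q k, x ∈ A q k → ∀ v,
      (fun s : ℝ => Metric.infDist (x + s • v) (A q k)) =o[𝓝 0] fun s => s := by
    simp only [ae_all_iff]
    exact fun q k => ae_isLittleO_infDist_add_smul (A q k)
  filter_upwards [hA] with x hxA c c' v hcc' hc
  obtain ⟨q, hcq, hqc'⟩ := exists_rat_btwn hcc'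
  obtain ⟨k, hk⟩ : ∃ k, x ∈ A q k := by
    obtain ⟨k, -, hk⟩ := hU.1.eventually_iff.1 (hc.weaken hcq.le).bound
    exact ⟨k, fun s hs => hk hs⟩
  have hη : 0 < (c' - q) / (L + 1) := div_pos (sub_pos.2 hqc') (by positivity)
  refine IsBigOWith.of_bound ?_
  filter_upwards [(hxA q k hk v).bound hη, hU.1.mem_of_mem (i := k) trivial] with s hs hsU
  rw [Real.norm_of_nonneg Metric.infDist_nonneg, Real.norm_eq_abs] at hs
  calc ‖R s (x + s • v)‖
      ≤ q * |s| + L * Metric.infDist (x + s • v) (A q k) :=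
        norm_le_add_mul_infDist (hR s) ⟨x, hk⟩ (fun z hz => hz s hsU) _
    _ ≤ q * |s| + (L + 1) * ((c' - q) / (L + 1) * |s|) := by
        gcongr
        · exact Metric.infDist_nonneg
        · exact le_add_of_nonneg_right zero_le_one
    _ = c' * ‖s‖ := by rw [Real.norm_eq_abs]; field_simp; ring

end Uniform

variable [NormedSpace ℝ F]

/-- The error of the linear approximation `f x + s • a` to `f` at `x + s • u`; it is `o(s)` as
`s → 0` exactly if `a` is the line derivative of `f` at `x` in the direction `u`. -/
def lineDerivRemainder (f : E → F) (u : E) (a : F) (x : E) (s : ℝ) : F :=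
  f (x + s • u) - f x - s • a

theorem lipschitzWith_lineDerivRemainder {f : E → F} {C : NNReal} (hf : LipschitzWith C f) (u : E)
    (a : F) (s : ℝ) : LipschitzWith (C + C) fun x => lineDerivRemainder f u a x s := by
  have hshift : LipschitzWith C fun x => f (x + s • u) := by
    simpa [Function.comp_def] using hf.comp (LipschitzWith.id.add (LipschitzWith.const (s • u)))
  simpa [lineDerivRemainder] using (hshift.sub hf).sub (LipschitzWith.const (s • a))

theorem norm_lineDerivRemainder_sub_le {f : E → F} {C : NNReal} (hf : LipschitzWith C f)
    (u u' : E) (a a' : F) (x : E) (s : ℝ) :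
    ‖lineDerivRemainder f u a x s - lineDerivRemainder f u' a' x s‖
      ≤ (C * ‖u - u'‖ + ‖a - a'‖) * ‖s‖ := by
  have hfu : ‖f (x + s • u) - f (x + s • u')‖ ≤ C * (‖s‖ * ‖u - u'‖) := by
    simpa [← smul_sub, norm_smul] using hf.norm_sub_le (x + s • u) (x + s • u')
  calc ‖lineDerivRemainder f u a x s - lineDerivRemainder f u' a' x s‖
      = ‖(f (x + s • u) - f (x + s • u')) - s • (a - a')‖ := by
        rw [lineDerivRemainder, lineDerivRemainder, smul_sub]; congr 1; abel
    _ ≤ C * (‖s‖ * ‖u - u'‖) + ‖s‖ * ‖a - a'‖ :=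
        (norm_sub_le _ _).trans <| add_le_add hfu <| norm_smul_le _ _
    _ = (C * ‖u - u'‖ + ‖a - a'‖) * ‖s‖ := by ring

theorem hasLineDerivAt_add_of_isLittleO_lineDerivRemainder {f : E → F} {h : D → E} {C : NNReal}
    (hf : LipschitzWith C f) {x v : D} {u w : E} {a b : F} (hw : HasLineDerivAt ℝ h w x v)
    (hb : HasLineDerivAt ℝ (f ∘ h) b x v)
    (ha : (fun s => lineDerivRemainder f u a (h (x + s • v)) s) =o[𝓝 0] fun s => s) :
    HasLineDerivAt ℝ f (a + b) (h x) (u + w) := by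
  rw [hasLineDerivAt_iff_isLittleO_nhds_zero] at hw hb ⊢
  have hshift : (fun s : ℝ => f (h x + s • (u + w)) - f (h (x + s • v) + s • u)) =o[𝓝 0]
      fun s => s := by
    refine IsBigO.trans_isLittleO (IsBigO.of_bound C (Eventually.of_forall fun s => ?_)) hw
    refine (hf.norm_sub_le _ _).trans_eq ?_
    rw [← norm_neg (h (x + s • v) - h x - s • w), smul_add]
    congr 2
    abel
  refine ((hshift.add ha).add hb).congr_left fun s => ?_
  simp only [lineDerivRemainder, Function.comp_apply, smul_add]
  abel

variable [FiniteDimensional ℝ D] [MeasurableSpace D] [BorelSpace D] {μ : Measure D}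
  [μ.IsAddHaarMeasure] [FiniteDimensional ℝ E] [FiniteDimensional ℝ F]
  {f : E → F} {h : D → E} {C K : NNReal}

theorem ae_isLittleO_lineDerivRemainder_comp_add_smul (hf : LipschitzWith C f)
    (hh : LipschitzWith K h) :
    ∀ᵐ x ∂μ, ∀ u a v, HasLineDerivAt ℝ f a (h x) u →
      (fun s => lineDerivRemainder f u a (h (x + s • v)) s) =o[𝓝 0] fun s => s := by
  let q : ℕ → E × F := TopologicalSpace.denseSeq (E × F)
  have hq : ∀ᵐ x ∂μ, ∀ n c c' v, c < c' →
      IsBigOWith c (𝓝 0) (fun s => lineDerivRemainder f (q n).1 (q n).2 (h x) s) (fun s => s) →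
      IsBigOWith c' (𝓝 0) (fun s => lineDerivRemainder f (q n).1 (q n).2 (h (x + s • v)) s)
        fun s => s :=
    ae_all_iff.2 fun n => ae_isBigOWith_add_smul fun s =>
      (lipschitzWith_lineDerivRemainder hf (q n).1 (q n).2 s).comp hh
  filter_upwards [hq] with x hx u a v hu
  replace hu : (fun s => lineDerivRemainder f u a (h x) s) =o[𝓝 0] fun s => s :=
    hasLineDerivAt_iff_isLittleO_nhds_zero.1 hu
  refine isLittleO_iff_forall_isBigOWith.2 fun c hc => ?_
  obtain ⟨ε, hε, hεc⟩ : ∃ ε > 0, 4 * ε = c := ⟨c / 4, by positivity, by ring⟩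
  obtain ⟨n, hn⟩ : ∃ n, C * ‖u - (q n).1‖ + ‖a - (q n).2‖ < ε := by
    have hcont : Continuous fun z : E × F => C * ‖u - z.1‖ + ‖a - z.2‖ := by fun_prop
    exact (TopologicalSpace.denseRange_denseSeq (E × F)).exists_mem_open
      (isOpen_lt hcont continuous_const) ⟨(u, a), by simpa using hε⟩
  have hclose : ∀ z : ℝ → E, IsBigOWith ε (𝓝 0) (fun s => lineDerivRemainder f u a (z s) s -
      lineDerivRemainder f (q n).1 (q n).2 (z s) s) fun s => s := fun z =>
    IsBigOWith.of_bound <| Eventually.of_forall fun s =>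
      (norm_lineDerivRemainder_sub_le hf u (q n).1 a (q n).2 (z s) s).trans (by gcongr)
  have hqx : IsBigOWith (2 * ε) (𝓝 0)
      (fun s => lineDerivRemainder f (q n).1 (q n).2 (h x) s) fun s => s :=
    (((hu.forall_isBigOWith hε).sub (hclose fun _ => h x)).congr_left fun s => by abel).weaken
      (by linarith)
  have hqxv := hx n (2 * ε) (3 * ε) v (by linarith) hqx
  exact (((hclose fun s => h (x + s • v)).add hqxv).congr_left fun s => by abel).weaken
    (by linarith)

theorem ae_fderiv_mem_additiveDirections (hf : LipschitzWith C f) (hh : LipschitzWith K h) :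
    ∀ᵐ x ∂μ, ∀ v, fderiv ℝ h x v ∈ additiveDirections f (h x) ∧
      HasLineDerivAt ℝ f (fderiv ℝ (f ∘ h) x v) (h x) (fderiv ℝ h x v) := by
  filter_upwards [ae_isLittleO_lineDerivRemainder_comp_add_smul hf hh, hh.ae_differentiableAt,
    (hf.comp hh).ae_differentiableAt] with x hx hhx hfhx v
  have hadd : ∀ u a, HasLineDerivAt ℝ f a (h x) u →
      HasLineDerivAt ℝ f (a + fderiv ℝ (f ∘ h) x v) (h x) (u + fderiv ℝ h x v) := fun u a hu =>
    hasLineDerivAt_add_of_isLittleO_lineDerivRemainder hf (hhx.hasFDerivAt.hasLineDerivAt v)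
      (hfhx.hasFDerivAt.hasLineDerivAt v) (hx u a v hu)
  exact ⟨mem_additiveDirections_of_forall_hasLineDerivAt hadd,
    by simpa using hadd 0 0 hasLineDerivAt_zero⟩

theorem ae_differentiableAt_of_lipschitzOnWith {Ω : Set D} (hΩ : IsOpen Ω)
    {h : D → F} (hh : LipschitzOnWith K h Ω) :
    ∀ᵐ x ∂μ.restrict Ω, DifferentiableAt ℝ h x := by
  filter_upwards [hh.ae_differentiableWithinAt hΩ.measurableSet,
    ae_restrict_mem hΩ.measurableSet] with x hx hxΩ
  exact hx.differentiableAt (hΩ.mem_nhds hxΩ)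

theorem ae_fderiv_comp_eq_of_hasFDerivAlong {U : Set E} {Ω : Set D} (hU : IsOpen U)
    (hΩ : IsOpen Ω) (hf : LipschitzOnWith C f U) (hh : LipschitzOnWith K h Ω)
    (hmaps : MapsTo h Ω U) :
    ∀ᵐ x ∂μ.restrict Ω, ∀ T : E →L[ℝ] F,
      HasFDerivAlong f T (additiveDirections f (h x)) (h x) →
        fderiv ℝ (f ∘ h) x = T.comp (fderiv ℝ h x) := by
  obtain ⟨f', hf', hff'⟩ := hf.extend_finite_dimension
  obtain ⟨h', hh', hhh'⟩ := hh.extend_finite_dimension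
  filter_upwards [ae_restrict_of_ae (ae_fderiv_mem_additiveDirections hf' hh'),
    ae_restrict_mem hΩ.measurableSet] with x hx hxΩ T hT
  have hhx : h =ᶠ[𝓝 x] h' := hhh'.eventuallyEq_of_mem (hΩ.mem_nhds hxΩ)
  have hfx : f =ᶠ[𝓝 (h x)] f' := hff'.eventuallyEq_of_mem (hU.mem_nhds (hmaps hxΩ))
  have hfhx : f ∘ h =ᶠ[𝓝 x] f' ∘ h' := by
    filter_upwards [hΩ.mem_nhds hxΩ] with z hz
    rw [Function.comp_apply, Function.comp_apply, ← hhh' hz, hff' (hmaps hz)]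
  rw [← hhx.fderiv_eq, ← hfhx.fderiv_eq, ← hhx.eq_of_nhds, ← additiveDirections_congr hfx] at hx
  ext1 v
  obtain ⟨hv, hv'⟩ := hx v
  exact (hv'.congr_of_eventuallyEq hfx).unique (hT _ hv)

theorem ae_fderiv_comp_graph_eq_of_hasFDerivAlong {A : Type*} [NormedAddCommGroup A]
    [NormedSpace ℝ A] [FiniteDimensional ℝ A] {f : A × D → F} {b : D → A} {Ω : Set D}
    (hΩ : IsOpen Ω) (hf : LipschitzOnWith C f (univ ×ˢ Ω)) (hb : LipschitzOnWith K b Ω) :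
    ∀ᵐ t ∂μ.restrict Ω, ∀ T : A × D →L[ℝ] F,
      HasFDerivAlong f T (additiveDirections f (b t, t)) (b t, t) →
        fderiv ℝ (fun s => f (b s, s)) t =
          (T.comp (ContinuousLinearMap.inl ℝ A D)).comp (fderiv ℝ b t) +
            T.comp (ContinuousLinearMap.inr ℝ A D) := by
  filter_upwards [ae_fderiv_comp_eq_of_hasFDerivAlong (isOpen_univ.prod hΩ) hΩ hf
      (hb.prodMk LipschitzWith.id.lipschitzOnWith) fun t ht => ⟨mem_univ _, ht⟩,
    ae_differentiableAt_of_lipschitzOnWith hΩ hb] with t ht hbt T hT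
  have hgraph : fderiv ℝ (fun s => (b s, s)) t =
      (fderiv ℝ b t).prod (ContinuousLinearMap.id ℝ D) :=
    (hbt.hasFDerivAt.prodMk (hasFDerivAt_id t)).fderiv
  refine (ht T hT).trans ?_
  ext1 v
  simp [hgraph, ← map_add]

end TangentialLinearity

section WeakDerivatives

variable {n p : ℕ} {Ω : Set (EuclideanSpace ℝ (Fin n))}

theorem integrableOn_mul_of_tsupport_subset {X : Type*} [TopologicalSpace X] [T2Space X]
    [MeasurableSpace X] [OpensMeasurableSpace X] {μ : Measure X}
    {S : Set X} {g φ : X → ℝ} (hg : LocallyIntegrableOn g S μ) (hφ : Continuous φ)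
    (hc : HasCompactSupport φ) (hs : tsupport φ ⊆ S) :
    IntegrableOn (fun x => g x * φ x) S μ := by
  have hK : IntegrableOn (fun x => g x * φ x) (tsupport φ) μ :=
    (hg.integrableOn_compact_subset hs hc).mul_continuousOn hφ.continuousOn hc
  exact ((integrableOn_iff_integrable_of_support_subset fun x hx =>
    subset_tsupport φ (right_ne_zero_of_mul hx)).1 hK).integrableOn

theorem IsWeakPartialDeriv.congr {i : Fin n} {f f' g g' : EuclideanSpace ℝ (Fin n) → ℝ}
    (h : IsWeakPartialDeriv Ω i f g) (hf : f =ᵐ[volume.restrict Ω] f')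
    (hg : g =ᵐ[volume.restrict Ω] g') : IsWeakPartialDeriv Ω i f' g' := by
  obtain ⟨hfi, hgi, hfg⟩ := h
  refine ⟨hfi.congr hf, hgi.congr hg, fun φ hφ hc hs => ?_⟩
  have hint : ∀ {k k' u : EuclideanSpace ℝ (Fin n) → ℝ}, k =ᵐ[volume.restrict Ω] k' →
      ∫ a in Ω, k a * u a = ∫ a in Ω, k' a * u a := fun hk =>
    integral_congr_ae (hk.mul (ae_eq_refl _))
  rw [← hint hg, ← hint hf]
  exact hfg φ hφ hc hs

theorem IsWeakPartialDeriv.ae_eq {i : Fin n} {f g g' : EuclideanSpace ℝ (Fin n) → ℝ}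
    (h : IsWeakPartialDeriv Ω i f g) (h' : IsWeakPartialDeriv Ω i f g') (hΩ : IsOpen Ω) :
    g =ᵐ[volume.restrict Ω] g' := by
  obtain ⟨-, hg, hfg⟩ := h
  obtain ⟨-, hg', hfg'⟩ := h'
  rw [EventuallyEq, ae_restrict_iff' hΩ.measurableSet]
  have hzero : ∀ᵐ x, x ∈ Ω → (g - g') x = 0 := by
    refine hΩ.ae_eq_zero_of_integral_contDiff_smul_eq_zero (hg.sub hg') fun φ hφ hc hs => ?_
    have hφ₁ : ContDiff ℝ 1 φ := hφ.of_le (by exact_mod_cast le_top)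
    calc ∫ x, φ x • (g - g') x = ∫ x in Ω, φ x • (g - g') x := by
          refine (setIntegral_eq_integral_of_forall_compl_eq_zero fun x hx => ?_).symm
          rw [image_eq_zero_of_notMem_tsupport fun hx' => hx (hs hx'), zero_smul]
      _ = ∫ x in Ω, (g x * φ x - g' x * φ x) := by
          simp only [Pi.sub_apply, smul_eq_mul, mul_sub, mul_comm]
      _ = 0 := by
          rw [integral_sub (integrableOn_mul_of_tsupport_subset hg hφ.continuous hc hs)
            (integrableOn_mul_of_tsupport_subset hg' hφ.continuous hc hs),
            hfg φ hφ₁ hc hs, hfg' φ hφ₁ hc hs, sub_self]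
  filter_upwards [hzero] with x hx hxΩ using sub_eq_zero.1 (hx hxΩ)

theorem isWeakPartialDeriv_lineDeriv {f : EuclideanSpace ℝ (Fin n) → ℝ} {C : NNReal}
    (hf : LipschitzWith C f) (i : Fin n) :
    IsWeakPartialDeriv Ω i f fun x => lineDeriv ℝ f x (EuclideanSpace.single i 1) := by
  refine ⟨hf.continuous.locallyIntegrable.locallyIntegrableOn _,
    (hf.locallyIntegrable_lineDeriv _).locallyIntegrableOn _, fun φ hφ hc hs => ?_⟩
  obtain ⟨D, hD⟩ := hφ.lipschitzWith_of_hasCompactSupport hc one_ne_zero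
  have hφΩ : ∀ x ∉ Ω, x ∉ tsupport φ := fun x hx hx' => hx (hs hx')
  rw [setIntegral_eq_integral_of_forall_compl_eq_zero fun x hx => by
      rw [image_eq_zero_of_notMem_tsupport (hφΩ x hx), mul_zero],
    setIntegral_eq_integral_of_forall_compl_eq_zero fun x hx => by
      simp [fderiv_of_notMem_tsupport ℝ (hφΩ x hx)],
    hf.integral_lineDeriv_mul_eq hD hc, ← integral_neg]
  refine integral_congr_ae (Eventually.of_forall fun x => ?_)
  simp only [(hφ.differentiable one_ne_zero x).lineDeriv_eq_fderiv, map_neg]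
  ring

section Jacobian

variable {f f' : EuclideanSpace ℝ (Fin n) → EuclideanSpace ℝ (Fin p)}
  {J J' : EuclideanSpace ℝ (Fin n) → EuclideanSpace ℝ (Fin n) →L[ℝ] EuclideanSpace ℝ (Fin p)}
  {C : NNReal}

theorem IsWeakJacobian.congr (h : IsWeakJacobian Ω f J) (hf : f =ᵐ[volume.restrict Ω] f')
    (hJ : J =ᵐ[volume.restrict Ω] J') : IsWeakJacobian Ω f' J' := fun k i =>
  (h k i).congr (hf.mono fun x hx => by simp only [hx]) (hJ.mono fun x hx => by simp only [hx])

theorem IsWeakJacobian.ae_eq (h : IsWeakJacobian Ω f J) (h' : IsWeakJacobian Ω f J')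
    (hΩ : IsOpen Ω) : J =ᵐ[volume.restrict Ω] J' := by
  have hentries : ∀ᵐ x ∂volume.restrict Ω, ∀ k i,
      J x (EuclideanSpace.single i 1) k = J' x (EuclideanSpace.single i 1) k := by
    simp only [ae_all_iff]
    exact fun k i => (h k i).ae_eq (h' k i) hΩ
  filter_upwards [hentries] with x hx
  refine ContinuousLinearMap.coe_injective
    ((EuclideanSpace.basisFun (Fin n) ℝ).toBasis.ext fun i => ?_)
  ext k
  simpa using hx k i

theorem IsWeakJacobian.weaklyDifferentiableOn (h : IsWeakJacobian Ω f J) :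
    WeaklyDifferentiableOn Ω f := fun k i => ⟨_, h k i⟩

theorem isWeakJacobian_fderiv (hf : LipschitzWith C f) : IsWeakJacobian Ω f (fderiv ℝ f) := by
  intro k i
  let π : EuclideanSpace ℝ (Fin p) →L[ℝ] ℝ := EuclideanSpace.proj k
  refine (isWeakPartialDeriv_lineDeriv (π.lipschitz.comp hf) i).congr EventuallyEq.rfl
    (ae_restrict_of_ae ?_)
  filter_upwards [hf.ae_differentiableAt] with x hx
  exact ((π.hasFDerivAt.comp x hx.hasFDerivAt).hasLineDerivAt _).lineDeriv

theorem isWeakJacobian_of_lipschitzOnWith (hΩ : IsOpen Ω) (hf : LipschitzOnWith C f Ω)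
    (hJ : ∀ x ∈ Ω, DifferentiableAt ℝ f x → J x = fderiv ℝ f x) : IsWeakJacobian Ω f J := by
  obtain ⟨g, hg, hfg⟩ := hf.extend_finite_dimension
  refine (isWeakJacobian_fderiv hg).congr
    (ae_restrict_of_forall_mem hΩ.measurableSet hfg.symm) ?_
  filter_upwards [ae_differentiableAt_of_lipschitzOnWith hΩ hf,
    ae_restrict_mem hΩ.measurableSet] with x hx hxΩ
  rw [hJ x hxΩ hx, (hfg.eventuallyEq_of_mem (hΩ.mem_nhds hxΩ)).fderiv_eq]

theorem IsWeakJacobian.ae_eq_fderiv (h : IsWeakJacobian Ω f J) (hΩ : IsOpen Ω)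
    (hf : LipschitzOnWith C f Ω) : J =ᵐ[volume.restrict Ω] fderiv ℝ f :=
  h.ae_eq (isWeakJacobian_of_lipschitzOnWith hΩ hf fun _ _ _ => rfl) hΩ

end Jacobian

end WeakDerivatives

section ChainRule

variable {m p : ℕ} {C C' : NNReal}

theorem exists_isWeakJacobian_comp {U : Set (EuclideanSpace ℝ (Fin m))}
    {f : EuclideanSpace ℝ (Fin m) → EuclideanSpace ℝ (Fin p)} (hU : IsOpen U)
    (hf : LipschitzOnWith C f U) :
    ∃ J : EuclideanSpace ℝ (Fin m) → EuclideanSpace ℝ (Fin m) →L[ℝ] EuclideanSpace ℝ (Fin p),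
      IsWeakJacobian U f J ∧ (∀ a, DifferentiableAt ℝ f a → J a = fderiv ℝ f a) ∧
      ∀ {n : ℕ} {Ω : Set (EuclideanSpace ℝ (Fin n))}
        {h : EuclideanSpace ℝ (Fin n) → EuclideanSpace ℝ (Fin m)} {K : NNReal}
        {Jh : EuclideanSpace ℝ (Fin n) → EuclideanSpace ℝ (Fin n) →L[ℝ] EuclideanSpace ℝ (Fin m)}
        {Jfh : EuclideanSpace ℝ (Fin n) → EuclideanSpace ℝ (Fin n) →L[ℝ] EuclideanSpace ℝ (Fin p)},
        IsOpen Ω → LipschitzOnWith K h Ω → MapsTo h Ω U →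
        IsWeakJacobian Ω h Jh → IsWeakJacobian Ω (f ∘ h) Jfh →
        ∀ᵐ x ∂volume.restrict Ω, Jfh x = (J (h x)).comp (Jh x) := by
  choose J hJ hJfderiv using exists_hasFDerivAlong_additiveDirections_and_eq_fderiv f
  refine ⟨J, isWeakJacobian_of_lipschitzOnWith hU hf fun a _ => hJfderiv a, hJfderiv, ?_⟩
  intro n Ω h K Jh Jfh hΩ hh hmaps hJh hJfh
  filter_upwards [hJh.ae_eq_fderiv hΩ hh, hJfh.ae_eq_fderiv hΩ (hf.comp hh hmaps),
    ae_fderiv_comp_eq_of_hasFDerivAlong hU hΩ hf hh hmaps] with x hx hfx hcomp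
  rw [hx, hfx, hcomp _ (hJ (h x))]

theorem lipschitzOnWith_uncurry {X Y Z : Type*} [PseudoEMetricSpace X] [PseudoEMetricSpace Y]
    [PseudoEMetricSpace Z] {f : X → Y → Z} {s : Set X} {t : Set Y}
    (h₁ : ∀ y ∈ t, LipschitzOnWith C (fun x => f x y) s)
    (h₂ : ∀ x ∈ s, LipschitzOnWith C' (f x) t) :
    LipschitzOnWith (C + C') (fun z : X × Y => f z.1 z.2) (s ×ˢ t) := by
  rintro ⟨x₁, y₁⟩ ⟨hx₁, hy₁⟩ ⟨x₂, y₂⟩ ⟨hx₂, hy₂⟩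
  rw [ENNReal.coe_add, add_mul]
  calc edist (f x₁ y₁) (f x₂ y₂) ≤ edist (f x₁ y₁) (f x₂ y₁) + edist (f x₂ y₁) (f x₂ y₂) :=
        edist_triangle _ _ _
    _ ≤ C * edist x₁ x₂ + C' * edist y₁ y₂ := add_le_add (h₁ y₁ hy₁ hx₁ hx₂) (h₂ x₂ hx₂ hy₁ hy₂)
    _ ≤ C * edist (x₁, y₁) (x₂, y₂) + C' * edist (x₁, y₁) (x₂, y₂) := by
        gcongr
        · exact le_max_left _ _
        · exact le_max_right _ _

theorem exists_isWeakJacobian_partial {n : ℕ} {Ω : Set (EuclideanSpace ℝ (Fin n))}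
    {f : EuclideanSpace ℝ (Fin m) → EuclideanSpace ℝ (Fin n) → EuclideanSpace ℝ (Fin p)}
    (hΩ : IsOpen Ω) (h₁ : ∀ t ∈ Ω, LipschitzWith C fun a => f a t)
    (h₂ : ∀ a, LipschitzOnWith C' (f a) Ω) :
    ∃ (J₁ : EuclideanSpace ℝ (Fin m) → EuclideanSpace ℝ (Fin n) →
          EuclideanSpace ℝ (Fin m) →L[ℝ] EuclideanSpace ℝ (Fin p))
      (J₂ : EuclideanSpace ℝ (Fin m) → EuclideanSpace ℝ (Fin n) →
          EuclideanSpace ℝ (Fin n) →L[ℝ] EuclideanSpace ℝ (Fin p)),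
      (∀ t ∈ Ω, IsWeakJacobian univ (fun a => f a t) fun a => J₁ a t) ∧
      (∀ a, IsWeakJacobian Ω (f a) (J₂ a)) ∧
      (∀ a t, DifferentiableAt ℝ (fun b => f b t) a → J₁ a t = fderiv ℝ (fun b => f b t) a) ∧
      (∀ a t, DifferentiableAt ℝ (f a) t → J₂ a t = fderiv ℝ (f a) t) ∧
      ∀ {b : EuclideanSpace ℝ (Fin n) → EuclideanSpace ℝ (Fin m)} {K : NNReal}
        {Jb : EuclideanSpace ℝ (Fin n) → EuclideanSpace ℝ (Fin n) →L[ℝ] EuclideanSpace ℝ (Fin m)}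
        {J : EuclideanSpace ℝ (Fin n) → EuclideanSpace ℝ (Fin n) →L[ℝ] EuclideanSpace ℝ (Fin p)},
        LipschitzOnWith K b Ω → IsWeakJacobian Ω b Jb →
        IsWeakJacobian Ω (fun t => f (b t) t) J →
        ∀ᵐ t ∂volume.restrict Ω, J t = (J₁ (b t) t).comp (Jb t) + J₂ (b t) t := by
  have hf : LipschitzOnWith (C + C') (fun z => f z.1 z.2) (univ ×ˢ Ω) :=
    lipschitzOnWith_uncurry (fun t ht => (h₁ t ht).lipschitzOnWith) fun a _ => h₂ a
  choose T hT hT₁ hT₂ using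
    exists_hasFDerivAlong_additiveDirections_and_eq_partial_fderiv fun z => f z.1 z.2
  refine ⟨fun a t => (T a t).comp (.inl ℝ _ _), fun a t => (T a t).comp (.inr ℝ _ _),
    fun t ht => isWeakJacobian_of_lipschitzOnWith isOpen_univ (h₁ t ht).lipschitzOnWith
      fun a _ => hT₁ a t,
    fun a => isWeakJacobian_of_lipschitzOnWith hΩ (h₂ a) fun t _ => hT₂ a t, hT₁, hT₂, ?_⟩
  intro b K Jb J hb hJb hJ
  have hfb := hf.comp (hb.prodMk LipschitzWith.id.lipschitzOnWith) fun t ht => ⟨mem_univ _, ht⟩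
  filter_upwards [hJb.ae_eq_fderiv hΩ hb, hJ.ae_eq_fderiv hΩ hfb,
    ae_fderiv_comp_graph_eq_of_hasFDerivAlong hΩ hf hb] with t hbt hft hgraph
  rw [hbt, hft, hgraph _ (hT (b t) t)]

end ChainRule

theorem exists_lipschitzOnWith_auxIterate {A Y T : Type*} [PseudoEMetricSpace A]
    [PseudoEMetricSpace T] {ψ : A → Y → T → A} {a₀ : Y → T → A} {y : Y} {Θ : Set T}
    {K₀ K₁ K₃ : NNReal} (hψ₁ : ∀ θ ∈ Θ, LipschitzWith K₁ fun a => ψ a y θ)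
    (hψ₃ : ∀ a, LipschitzOnWith K₃ (ψ a y) Θ) (ha₀ : LipschitzOnWith K₀ (a₀ y) Θ) (l : ℕ) :
    ∃ C, LipschitzOnWith C (auxIterate ψ a₀ l y) Θ := by
  induction l with
  | zero => exact ⟨K₀, ha₀⟩
  | succ l ih =>
    obtain ⟨C, hC⟩ := ih
    have hψ : LipschitzOnWith (K₁ + K₃) (fun z : A × T => ψ z.1 y z.2) (univ ×ˢ Θ) :=
      lipschitzOnWith_uncurry (fun θ hθ => (hψ₁ θ hθ).lipschitzOnWith) fun a _ => hψ₃ a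
    exact ⟨_, hψ.comp (hC.prodMk LipschitzWith.id.lipschitzOnWith) fun θ hθ => ⟨mem_univ _, hθ⟩⟩

theorem mainTheorem7_general {m N d : ℕ} {Y : Type*}
    {Θ : Set (EuclideanSpace ℝ (Fin d))} (hΘ : IsOpen Θ)
    {γ : EuclideanSpace ℝ (Fin m) → EuclideanSpace ℝ (Fin N)}
    {ψ : EuclideanSpace ℝ (Fin m) → Y → EuclideanSpace ℝ (Fin d) → EuclideanSpace ℝ (Fin m)}
    {y : Y} {K K₁ K₃ : NNReal} (hγ : LipschitzWith K γ)
    (hψ₁ : ∀ θ ∈ Θ, LipschitzWith K₁ (fun a => ψ a y θ))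
    (hψ₃ : ∀ a, LipschitzOnWith K₃ (fun θ => ψ a y θ) Θ) :
    ∃ (Γ : EuclideanSpace ℝ (Fin m) →
          EuclideanSpace ℝ (Fin m) →L[ℝ] EuclideanSpace ℝ (Fin N))
      (Ψa : EuclideanSpace ℝ (Fin m) → EuclideanSpace ℝ (Fin d) →
          EuclideanSpace ℝ (Fin m) →L[ℝ] EuclideanSpace ℝ (Fin m))
      (Ψθ : EuclideanSpace ℝ (Fin m) → EuclideanSpace ℝ (Fin d) →
          EuclideanSpace ℝ (Fin d) →L[ℝ] EuclideanSpace ℝ (Fin m)),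
      IsWeakJacobian univ γ Γ ∧
      (∀ θ ∈ Θ, IsWeakJacobian univ (fun a => ψ a y θ) (fun a => Ψa a θ)) ∧
      (∀ a, IsWeakJacobian Θ (fun θ => ψ a y θ) (fun θ => Ψθ a θ)) ∧
      (∀ a, DifferentiableAt ℝ γ a → Γ a = fderiv ℝ γ a) ∧
      (∀ a θ, DifferentiableAt ℝ (fun b => ψ b y θ) a → Ψa a θ = fderiv ℝ (fun b => ψ b y θ) a) ∧
      (∀ a θ, DifferentiableAt ℝ (fun t => ψ a y t) θ → Ψθ a θ = fderiv ℝ (fun t => ψ a y t) θ) ∧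
      ∀ (a₀ : Y → EuclideanSpace ℝ (Fin d) → EuclideanSpace ℝ (Fin m)) (K₀ : NNReal),
        LipschitzOnWith K₀ (a₀ y) Θ →
        (∀ l, WeaklyDifferentiableOn Θ (auxIterate ψ a₀ l y)) ∧
        (∀ l, WeaklyDifferentiableOn Θ (mainIterate γ ψ a₀ l y)) ∧
        ∀ (Ja : ℕ → EuclideanSpace ℝ (Fin d) →
              EuclideanSpace ℝ (Fin d) →L[ℝ] EuclideanSpace ℝ (Fin m))
          (Jx : ℕ → EuclideanSpace ℝ (Fin d) →
              EuclideanSpace ℝ (Fin d) →L[ℝ] EuclideanSpace ℝ (Fin N)),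
          (∀ l, IsWeakJacobian Θ (auxIterate ψ a₀ l y) (Ja l)) →
          (∀ l, IsWeakJacobian Θ (mainIterate γ ψ a₀ l y) (Jx l)) →
          ∀ l,
            (∀ᵐ θ ∂volume.restrict Θ,
              Jx l θ = (Γ (auxIterate ψ a₀ l y θ)).comp (Ja l θ)) ∧
            (∀ᵐ θ ∂volume.restrict Θ,
              Ja (l + 1) θ = (Ψa (auxIterate ψ a₀ l y θ) θ).comp (Ja l θ) +
                Ψθ (auxIterate ψ a₀ l y θ) θ) := by
  obtain ⟨Γ, hΓ, hΓ', hΓcomp⟩ :=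
    exists_isWeakJacobian_comp isOpen_univ (hγ.lipschitzOnWith (s := univ))
  obtain ⟨Ψa, Ψθ, hΨa, hΨθ, hΨa', hΨθ', hΨcomp⟩ := exists_isWeakJacobian_partial hΘ hψ₁ hψ₃
  refine ⟨Γ, Ψa, Ψθ, hΓ, hΨa, hΨθ, hΓ', hΨa', hΨθ', fun a₀ K₀ ha₀ => ?_⟩
  choose C hC using exists_lipschitzOnWith_auxIterate hψ₁ hψ₃ ha₀
  have haux : ∀ l, WeaklyDifferentiableOn Θ (auxIterate ψ a₀ l y) := fun l =>
    (isWeakJacobian_of_lipschitzOnWith hΘ (hC l) fun _ _ _ => rfl).weaklyDifferentiableOn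
  have hmain : ∀ l, WeaklyDifferentiableOn Θ (mainIterate γ ψ a₀ l y) := fun l =>
    (isWeakJacobian_of_lipschitzOnWith hΘ (hγ.comp_lipschitzOnWith (hC l))
      fun _ _ _ => rfl).weaklyDifferentiableOn
  exact ⟨haux, hmain, fun Ja Jx hJa hJx l =>
    ⟨hΓcomp hΘ (hC l) (mapsTo_univ _ _) (hJa l) (hJx l), hΨcomp (hC l) (hJa l) (hJa (l + 1))⟩⟩

theorem mainTheorem7 {m N P d : ℕ}
    (Θ : Set (EuclideanSpace ℝ (Fin d))) (hΘ : IsOpen Θ)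
    (γ : EuclideanSpace ℝ (Fin m) → EuclideanSpace ℝ (Fin N))
    (ψ : EuclideanSpace ℝ (Fin m) → EuclideanSpace ℝ (Fin P) → EuclideanSpace ℝ (Fin d) →
      EuclideanSpace ℝ (Fin m))
    (a₀ : EuclideanSpace ℝ (Fin P) → EuclideanSpace ℝ (Fin d) → EuclideanSpace ℝ (Fin m))
    (y : EuclideanSpace ℝ (Fin P)) (K₀ K₁ K₃ : NNReal)
    (hγ : LipschitzWith 1 γ)
    (hψ₁ : ∀ θ ∈ Θ, LipschitzWith K₁ (fun a => ψ a y θ))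
    (hψ₃ : ∀ a, LipschitzOnWith K₃ (fun θ => ψ a y θ) Θ)
    (ha₀ : LipschitzOnWith K₀ (fun θ => a₀ y θ) Θ) :
    -- the iterates are weakly differentiable in `θ`
    (∀ l, WeaklyDifferentiableOn Θ (auxIterate ψ a₀ l y)) ∧
    (∀ l, WeaklyDifferentiableOn Θ (mainIterate γ ψ a₀ l y)) ∧
    -- there are versions `Γ`, `Ψa`, `Ψθ` of the weak Jacobians of `γ`, of `ψ` in its first
    -- argument and of `ψ` in its third argument, equal to the classical ones where these exist,
    ∃ (Γ : EuclideanSpace ℝ (Fin m) →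
          EuclideanSpace ℝ (Fin m) →L[ℝ] EuclideanSpace ℝ (Fin N))
      (Ψa : EuclideanSpace ℝ (Fin m) → EuclideanSpace ℝ (Fin d) →
          EuclideanSpace ℝ (Fin m) →L[ℝ] EuclideanSpace ℝ (Fin m))
      (Ψθ : EuclideanSpace ℝ (Fin m) → EuclideanSpace ℝ (Fin d) →
          EuclideanSpace ℝ (Fin d) →L[ℝ] EuclideanSpace ℝ (Fin m)),
      IsWeakJacobian Set.univ γ Γ ∧
      (∀ θ ∈ Θ, IsWeakJacobian Set.univ (fun a => ψ a y θ) (fun a => Ψa a θ)) ∧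
      (∀ a, IsWeakJacobian Θ (fun θ => ψ a y θ) (fun θ => Ψθ a θ)) ∧
      (∀ a, DifferentiableAt ℝ γ a → Γ a = fderiv ℝ γ a) ∧
      (∀ a, ∀ θ ∈ Θ, DifferentiableAt ℝ (fun b => ψ b y θ) a →
        Ψa a θ = fderiv ℝ (fun b => ψ b y θ) a) ∧
      (∀ a, ∀ θ ∈ Θ, DifferentiableAt ℝ (fun t => ψ a y t) θ →
        Ψθ a θ = fderiv ℝ (fun t => ψ a y t) θ) ∧
      -- for which the weak Jacobians in `θ` of the iterates obey the recursion, for a.e. `θ`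
      ∀ (Ja : ℕ → EuclideanSpace ℝ (Fin d) →
            EuclideanSpace ℝ (Fin d) →L[ℝ] EuclideanSpace ℝ (Fin m))
        (Jx : ℕ → EuclideanSpace ℝ (Fin d) →
            EuclideanSpace ℝ (Fin d) →L[ℝ] EuclideanSpace ℝ (Fin N)),
        (∀ l, IsWeakJacobian Θ (auxIterate ψ a₀ l y) (Ja l)) →
        (∀ l, IsWeakJacobian Θ (mainIterate γ ψ a₀ l y) (Jx l)) →
        ∀ l,
          (∀ᵐ θ ∂(volume.restrict Θ),
            Jx l θ = (Γ (auxIterate ψ a₀ l y θ)).comp (Ja l θ)) ∧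
          (∀ᵐ θ ∂(volume.restrict Θ),
            Ja (l + 1) θ =
              (Ψa (auxIterate ψ a₀ l y θ) θ).comp (Ja l θ) +
                Ψθ (auxIterate ψ a₀ l y θ) θ) := by
  obtain ⟨Γ, Ψa, Ψθ, hΓ, hΨa, hΨθ, hΓ', hΨa', hΨθ', h⟩ := mainTheorem7_general hΘ hγ hψ₁ hψ₃
  obtain ⟨ha, hx, hrec⟩ := h a₀ K₀ ha₀
  exact ⟨ha, hx, Γ, Ψa, Ψθ, hΓ, hΨa, hΨθ, hΓ', fun a θ _ => hΨa' a θ, fun a θ _ => hΨθ' a θ, hrec⟩
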